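/- **Conventions.** Let $\mathfrak S_n$ be the set of permutations $\pi=\pi_1\cdots\pi_n$ of $\{1,\dots,n\}$. Put $\mathrm{Des}(\pi)=\{i:\pi_i>\pi_{i+1}\}$ and $\mathrm{Peak}(\pi)=\{s\in\mathrm{Des}(\pi): s\neq 1,\ s-1\notin\mathrm{Des}(\pi)\}$. For a set $\Pi$ of permutations (of any sizes, possibly infinite or empty), $\mathrm{Av}_n(\Pi)$ is the set of $\pi\in\mathfrak S_n$ containing no pattern in $\Pi$, where $\pi$ contains $\tau\in\mathfrak S_k$ if some subsequence of $\pi$ of length $k$ has the same relative order as $\tau$. For a composition $\alpha=(\alpha_1,\dots,\alpha_k)$ of $n$, let $M_\alpha=\sum_{i_1<\cdots<i_k}x_{i_1}^{\alpha_1}\cdots x_{i_k}^{\alpha_k}\in\mathbb C[[x_1,x_2,\dots]]$, let $F_\alpha=\sum_\beta M_\beta$ over all compositions $\beta$ of $n$ refining $\alpha$, and let $\mathrm{set}(\alpha)=\{\alpha_1,\alpha_1+\alpha_2,\dots,\alpha_1+\cdots+\alpha_{k-1}\}$. For $n\ge 1$ and a set $S\subseteq\{2,\dots,n-1\}$ containing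 no two consecutive integers, the peak function is $$K_{S,n}=2^{|S|+1}\sum_{\beta\vDash n,\ S\subseteq \mathrm{set}(\beta)\,\triangle\,(\mathrm{set}(\beta)+1)}F_\beta ,$$ where $\triangle$ is the symmetric difference, $\mathrm{set}(\beta)+1=\{x+1:x\in\mathrm{set}(\beta)\}$, and $\beta\vDash n$ means that $\beta$ is a composition of $n$; moreover $K_{\emptyset,0}=1$. For $n\ge 0$ put $$R_n(\Pi)=\sum_{\pi\in\mathrm{Av}_n(\Pi)}K_{\mathrm{Peak}(\pi),n}.$$ For $\pi\in\mathfrak S_m$ and $\sigma\in\mathfrak S_n$, the shuffle product $\pi ⧢ \sigma$ is the set of all permutations in $\mathfrak S_{m+n}$ that have both $\pi_1\cdots\pi_m$ and $(\sigma_1+m)\cdots(\sigma_n+m)$ as subsequences. For sets of permutations, $\Pi ⧢ \Pi'=\bigcup_{\pi\in\Pi,\ \sigma\in\Pi'}\pi ⧢ \sigma$. **Theorem 3.13.** Let $\Pi$ and $\Pi'$ be any sets of nonempty permutations (i.e. permutations of size at least $1$), and let $n\ge 0$. Then $$R_n(\Pi ⧢ \Pi') = R_n(\Pi') +\sum_{k=0}^{n-1}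 R_k(\Pi)\bigl[K_{\emptyset,1}R_{n-k-1}(\Pi')-R_{n-k}(\Pi')\bigr].$$ -/

import Mathlib

noncomputable section

namespace PeakAvoid

open Finset
open scoped Classical

/-! Formal power series over `ℂ` in the countably many variables `X 0, X 1, X 2, …`, which stand
for `x₁, x₂, x₃, …` -/

/-- The algebra `ℂ[[x₁, x₂, …]]`. -/
abbrev Series : Type := MvPowerSeries ℕ ℂ

/-- The exponent vector of `x_{i₁}^{α₁} ⋯ x_{i_k}^{α_k}`. -/
def monomialExp {n : ℕ} (α : Composition n) (i : Fin α.length → ℕ) : ℕ →₀ ℕ :=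
  ∑ j : Fin α.length, Finsupp.single (i j) (α.blocksFun j)

/-- The monomial quasisymmetric function `M_α`, the sum of all `x_{i₁}^{α₁} ⋯ x_{i_k}^{α_k}` with
`i₁ < ⋯ < i_k`. As the parts of `α` are positive, different index sequences give different
monomials, so that every coefficient is `0` or `1`. -/
def monomialQSym {n : ℕ} (α : Composition n) : Series := fun d =>
  if ∃ i : Fin α.length → ℕ, StrictMono i ∧ monomialExp α i = d then 1 else 0

/-- `β` refines `α` if `α` arises by adding together adjacent parts of `β` (`Composition.gather`
adds up the consecutive groups of parts of `β` whose sizes are the parts of `c`). -/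
def Refines {n : ℕ} (β α : Composition n) : Prop :=
  ∃ c : Composition β.length, β.gather c = α

/-- The fundamental quasisymmetric function `F_α`. -/
def fundamentalQSym {n : ℕ} (α : Composition n) : Series :=
  ∑ β : Composition n with Refines β α, monomialQSym β

/-- `set(β) = {β₁, β₁ + β₂, …, β₁ + ⋯ + β_{k-1}}`. -/
def compSet {n : ℕ} (β : Composition n) : Finset ℕ :=
  (Finset.Ioo 0 β.length).image β.sizeUpTo

/-- The peak function `K_{S,n}`, with the convention `K_{∅,0} = 1` in degree zero. -/
def peakFunction (S : Finset ℕ) (n : ℕ) : Series :=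
  if n = 0 then 1 else
    2 ^ (S.card + 1) *
      ∑ β : Composition n with S ⊆ symmDiff (compSet β) ((compSet β).image (· + 1)),
        fundamentalQSym β

/-- Permutations of arbitrary finite size. Positions and values are counted from `0` in `Fin n`. -/
abbrev FinPerm : Type := Σ n : ℕ, Equiv.Perm (Fin n)

/-- The descent set `{i : π_i > π_{i+1}}`, with positions counted from `1`. -/
def descentSet {n : ℕ} (π : Equiv.Perm (Fin n)) : Finset ℕ :=
  ({i : Fin n | ∃ h : (i : ℕ) + 1 < n, π ⟨(i : ℕ) + 1, h⟩ < π i} : Finset (Fin n)).image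
    (fun i => (i : ℕ) + 1)

/-- `Peak(S) = {s ∈ S : s ≠ 1, s - 1 ∉ S}`. -/
def peaksOf (S : Finset ℕ) : Finset ℕ :=
  {s ∈ S | s ≠ 1 ∧ ∀ t ∈ S, t + 1 ≠ s}

/-- The peak set of a permutation. -/
def peakSet {n : ℕ} (π : Equiv.Perm (Fin n)) : Finset ℕ :=
  peaksOf (descentSet π)

/-- `π` contains `τ` as a pattern: some subsequence of `π` has the same relative order as `τ`. -/
def ContainsPattern {n k : ℕ} (π : Equiv.Perm (Fin n)) (τ : Equiv.Perm (Fin k)) : Prop :=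
  ∃ f : Fin k ↪o Fin n, ∀ i j : Fin k, π (f i) < π (f j) ↔ τ i < τ j

/-- `Av_n(P)`, the permutations of size `n` that contain no pattern in `P`. -/
def avoiders (n : ℕ) (P : Set FinPerm) : Finset (Equiv.Perm (Fin n)) :=
  {π : Equiv.Perm (Fin n) | ∀ τ ∈ P, ¬ ContainsPattern π τ.2}

/-- The pattern-avoiding peak function `R_n(P)`. -/
def R (n : ℕ) (P : Set FinPerm) : Series :=
  ∑ π ∈ avoiders n P, peakFunction (peakSet π) n

/-- The shuffle product of `π` (of size `m`) and `σ` (of size `n`): all permutations of size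
`m + n` that have both `π₁ ⋯ π_m` and `(σ₁ + m) ⋯ (σ_n + m)` as subsequences. -/
def shufflePerm {m n : ℕ} (π : Equiv.Perm (Fin m)) (σ : Equiv.Perm (Fin n)) :
    Set (Equiv.Perm (Fin (m + n))) :=
  {ρ | (∃ f : Fin m ↪o Fin (m + n), ∀ i, ρ (f i) = Fin.castAdd n (π i)) ∧
       (∃ g : Fin n ↪o Fin (m + n), ∀ j, ρ (g j) = Fin.natAdd m (σ j))}

/-- The shuffle product of two sets of permutations, the union of all `π ⧢ σ` with `π ∈ P` and
`σ ∈ P'`. -/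
def shuffle (P P' : Set FinPerm) : Set FinPerm :=
  {τ | ∃ π ∈ P, ∃ σ ∈ P', ∃ ρ ∈ shufflePerm π.2 σ.2, τ = ⟨π.1 + σ.1, ρ⟩}

end PeakAvoid

end

/-!
The peak functions are the generating functions of *enriched* words. A letter is a pair of a natural
number `i` and a sign, and a word `w` contributes the monomial `∏ x_i` over its letters. Order
the positions of `w` by letter (first by number, then negative before positive), equal positive
letters from left to right and equal negative letters from right to left. The resulting permutation
of the positions is the standardization of `w`, and the words with standardization `π` have
generating function `K_{Peak(π),n}` (`peakFunction_peakSet_eq_wordSum`). To see this, fix the weakly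
increasing sequence `a` of the numbers of the letters, and let `E` be its set of ascents. Both
coefficients are `2 ^ (|E| + 1)` if every peak `s` of `π` has `s ∈ E` or `s - 1 ∈ E`, and `0`
otherwise. On the side of the words, every position outside `E` fixes the sign of one letter, and
two of these constraints collide exactly at a peak with neither `s` nor `s - 1` in `E`. On the side
of the fundamental expansion, the compositions are replaced by the subsets `D` of `E`, and each
`s ∈ S` halves the number of admissible `D` (`two_pow_mul_card_filter`).

Consequently `R n P` is the generating function of the words of length `n` none of whose subwords
has its standardization in `P` (`R_eq_wordSum`), and a product of such series is the generating
function of concatenations (`wordSum_mul`). A subword standardizes into `shuffle P P'` exactly if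
it is a concatenation of a subword standardizing into `P` and one standardizing into `P'`, so a word
avoids `shuffle P P'` if and only if at every cut the left part avoids `P` or the right part avoids
`P'` (`wordAvoids_shuffle_iff`). As the cut moves to the right, the left part stops avoiding `P`
at most once and the right part starts avoiding `P'` at most once; this turns the indicator of
avoidance into a telescoping sum (`indicator_forall_or_eq`), whose terms are those of the formula.
-/

noncomputable section

namespace PeakAvoid

open Finset
open scoped Classical

/-! ### Enriched words and their generating functions -/

/-- An enriched letter: a variable index and a sign, where `true` stands for positive and `false`
for negative. -/
abbrev Letter : Type := ℕ × Bool

/-- The exponent vector of the monomial of a word. Signs are forgotten. -/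
def content (w : List Letter) : ℕ →₀ ℕ := (w.map fun p => Finsupp.single p.1 1).sum

@[simp] lemma content_nil : content [] = 0 := rfl

@[simp] lemma content_cons (p : Letter) (w : List Letter) :
    content (p :: w) = Finsupp.single p.1 1 + content w := by simp [content]

@[simp] lemma content_append (u v : List Letter) : content (u ++ v) = content u + content v := by
  simp [content]

lemma content_ofFn {n : ℕ} (F : Fin n → Letter) :
    content (List.ofFn F) = ∑ v, Finsupp.single (F v).1 1 := by
  simp [content, List.map_ofFn, List.sum_ofFn]

lemma degree_content (w : List Letter) : (content w).degree = w.length := by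
  induction w with
  | nil => simp
  | cons p w ih => simp [ih, add_comm]

lemma mem_support_content {w : List Letter} {p : Letter} (hp : p ∈ w) :
    p.1 ∈ (content w).support := by
  induction w with
  | nil => simp at hp
  | cons q w ih =>
    simp only [Finsupp.mem_support_iff, content_cons, Finsupp.add_apply] at ih ⊢
    rcases List.mem_cons.1 hp with rfl | h
    · simp
    · have := ih h
      omega

lemma finite_content_eq (d : ℕ →₀ ℕ) : {w | content w = d}.Finite := by
  have h := (List.finite_length_eq (d.support × Bool) d.degree).image
    (List.map fun p => ((p.1 : ℕ), p.2))
  refine h.subset fun w hw => ?_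
  obtain rfl : content w = d := hw
  refine ⟨w.attach.map fun p => (⟨p.1.1, mem_support_content p.2⟩, p.1.2), ?_, ?_⟩
  · simp [degree_content]
  · simp only [List.map_map, Function.comp_def]
    exact List.attach_map_subtype_val w

/-- The words with a given monomial. -/
def wordsOfContent (d : ℕ →₀ ℕ) : Finset (List Letter) := (finite_content_eq d).toFinset

@[simp] lemma mem_wordsOfContent {d : ℕ →₀ ℕ} {w : List Letter} :
    w ∈ wordsOfContent d ↔ content w = d := by simp [wordsOfContent]

/-- The generating function `∑ w, f w * x ^ content w` of a weight `f` on words. -/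
def wordSum (f : List Letter → ℂ) : Series := fun d => ∑ w ∈ wordsOfContent d, f w

lemma coeff_wordSum (f : List Letter → ℂ) (d : ℕ →₀ ℕ) :
    MvPowerSeries.coeff d (wordSum f) = ∑ w ∈ wordsOfContent d, f w := rfl

lemma wordSum_add (f g : List Letter → ℂ) :
    wordSum (fun w => f w + g w) = wordSum f + wordSum g := by
  ext d; simp [coeff_wordSum, sum_add_distrib]

lemma wordSum_sub (f g : List Letter → ℂ) :
    wordSum (fun w => f w - g w) = wordSum f - wordSum g := by
  ext d; simp [coeff_wordSum, sum_sub_distrib]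

lemma wordSum_sum {ι : Type*} (s : Finset ι) (f : ι → List Letter → ℂ) :
    wordSum (fun w => ∑ i ∈ s, f i w) = ∑ i ∈ s, wordSum (f i) := by
  ext d; simp only [coeff_wordSum, map_sum]; exact sum_comm

/-- If `f` lives on words of length `k`, then a word with nonzero weight in the product is cut after
its first `k` letters in only one way. -/
lemma wordSum_mul {k : ℕ} {f : List Letter → ℂ} (hf : ∀ w, w.length ≠ k → f w = 0)
    (g : List Letter → ℂ) :
    wordSum f * wordSum g = wordSum fun w => f (w.take k) * g (w.drop k) := by
  ext d
  rw [MvPowerSeries.coeff_mul]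
  simp only [coeff_wordSum, sum_mul_sum, ← sum_product']
  rw [sum_sigma']
  have hk : ∀ u : List Letter, ∀ c : ℂ, f u * c ≠ 0 → u.length = k := fun u c h => by
    by_contra hu
    simp [hf u hu] at h
  refine sum_bij_ne_zero (fun x _ _ => x.2.1 ++ x.2.2) ?_ ?_ ?_ ?_
  · rintro ⟨p, u, v⟩ hx -
    simp only [mem_sigma, HasAntidiagonal.mem_antidiagonal, mem_product, mem_wordsOfContent] at hx
    simp [hx]
  · rintro ⟨⟨p, q⟩, u, v⟩ hx hx0 ⟨⟨p', q'⟩, u', v'⟩ hy hy0 h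
    simp only [mem_sigma, HasAntidiagonal.mem_antidiagonal, mem_product,
      mem_wordsOfContent] at hx hy
    have hu := hk _ _ hx0
    have hu' := hk _ _ hy0
    obtain ⟨h1, h2⟩ := List.append_inj h (hu.trans hu'.symm)
    dsimp only at h1 h2
    subst h1 h2
    obtain ⟨-, rfl, rfl⟩ := hx
    obtain ⟨-, rfl, rfl⟩ := hy
    rfl
  · intro w hw hw0
    refine ⟨⟨(content (w.take k), content (w.drop k)), w.take k, w.drop k⟩, ?_, hw0, by simp⟩
    simp only [mem_sigma, HasAntidiagonal.mem_antidiagonal, mem_product, mem_wordsOfContent,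
      and_true]
    rw [← content_append, List.take_append_drop]
    simpa using hw
  · rintro ⟨p, u, v⟩ hx hx0
    have hu := hk _ _ hx0
    simp [← hu]

/-! ### Standardization and avoidance -/

/-- The key by which the positions of a word are sorted. Letters are compared first; among equal
positive letters the position increases, among equal negative letters it decreases. -/
def sortKey {n : ℕ} (F : Fin n → Letter) (v : Fin n) : (ℕ ×ₗ Bool) ×ₗ ℤ :=
  toLex (toLex (F v), if (F v).2 then (v : ℤ) else -(v : ℤ))

lemma sortKey_injective {n : ℕ} (F : Fin n → Letter) : Function.Injective (sortKey F) := by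
  intro v w h
  simp only [sortKey, EmbeddingLike.apply_eq_iff_eq, Prod.mk.injEq] at h
  obtain ⟨h1, h2⟩ := h
  rw [h1] at h2
  apply Fin.ext
  split_ifs at h2 <;> omega

lemma sortKey_lt_iff {n : ℕ} (F : Fin n → Letter) (v w : Fin n) :
    sortKey F v < sortKey F w ↔ (F v).1 < (F w).1 ∨ (F v).1 = (F w).1 ∧
      ((F v).2 < (F w).2 ∨ (F v).2 = (F w).2 ∧ if (F v).2 then v < w else w < v) := by
  rw [sortKey, sortKey, Prod.Lex.toLex_lt_toLex, Prod.Lex.toLex_lt_toLex]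
  rcases hv : F v with ⟨a, ε⟩
  rcases hw : F w with ⟨b, δ⟩
  cases ε <;> cases δ <;> simp

/-- Restricting a word to a subword does not change the relative order of the positions. -/
lemma sortKey_comp_lt_iff {n k : ℕ} (F : Fin n → Letter) {g : Fin k → Fin n} (hg : StrictMono g)
    (v w : Fin k) :
    sortKey (F ∘ g) v < sortKey (F ∘ g) w ↔ sortKey F (g v) < sortKey F (g w) := by
  simp only [sortKey_lt_iff, Function.comp_apply, hg.lt_iff_lt]

/-- The permutation listing the positions of `F` in the order of their keys. -/
def sortPerm {n : ℕ} (F : Fin n → Letter) : Equiv.Perm (Fin n) := Tuple.sort (sortKey F)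

lemma sortPerm_eq_iff {n : ℕ} (F : Fin n → Letter) (ρ : Equiv.Perm (Fin n)) :
    sortPerm F = ρ ↔ StrictMono fun i => sortKey F (ρ i) := by
  rw [eq_comm, sortPerm, Tuple.eq_sort_iff]
  constructor
  · rintro ⟨h, -⟩
    exact h.strictMono_of_injective ((sortKey_injective F).comp ρ.injective)
  · intro h
    exact ⟨h.monotone, fun i j hij he => absurd he (h hij).ne⟩

lemma sortPerm_strictMono {n : ℕ} (F : Fin n → Letter) :
    StrictMono fun i => sortKey F (sortPerm F i) := (sortPerm_eq_iff F _).1 rfl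

lemma sortPerm_comp_eq_iff {n k : ℕ} (F : Fin n → Letter) {g : Fin k → Fin n} (hg : StrictMono g)
    (τ : Equiv.Perm (Fin k)) :
    sortPerm (F ∘ g) = τ ↔ ∃ f : Fin k ↪o Fin n, ∀ i, sortPerm F (f i) = g (τ i) := by
  rw [sortPerm_eq_iff]
  constructor
  · intro h
    have hf : StrictMono fun i => (sortPerm F).symm (g (τ i)) := fun i j hij => by
      rw [← (sortPerm_strictMono F).lt_iff_lt]
      simpa using (sortKey_comp_lt_iff F hg _ _).1 (h hij)
    exact ⟨OrderEmbedding.ofStrictMono _ hf, fun i => by simp⟩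
  · rintro ⟨f, hf⟩ i j hij
    simp only [sortKey_comp_lt_iff F hg, ← hf]
    exact sortPerm_strictMono F (f.strictMono hij)

/-- Positions of the pattern in `sortPerm F` correspond to values of `sortPerm F`, that is, to
positions of a subword of `F`. -/
lemma containsPattern_sortPerm_iff {n k : ℕ} (F : Fin n → Letter) (τ : Equiv.Perm (Fin k)) :
    ContainsPattern (sortPerm F) τ ↔ ∃ g : Fin k ↪o Fin n, sortPerm (F ∘ g) = τ := by
  constructor
  · rintro ⟨f, hf⟩
    have hg : StrictMono fun i => sortPerm F (f (τ.symm i)) := fun i j hij => by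
      simpa [hf] using hij
    refine ⟨OrderEmbedding.ofStrictMono _ hg, ?_⟩
    exact (sortPerm_comp_eq_iff F hg τ).2 ⟨f, fun i => by simp⟩
  · rintro ⟨g, hg⟩
    obtain ⟨f, hf⟩ := (sortPerm_comp_eq_iff F g.strictMono τ).1 hg
    exact ⟨f, fun i j => by simp [hf]⟩

lemma sortPerm_mem_shufflePerm_iff {m n : ℕ} (F : Fin (m + n) → Letter) (π : Equiv.Perm (Fin m))
    (σ : Equiv.Perm (Fin n)) :
    sortPerm F ∈ shufflePerm π σ ↔
      sortPerm (F ∘ Fin.castAdd n) = π ∧ sortPerm (F ∘ Fin.natAdd m) = σ := by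
  rw [sortPerm_comp_eq_iff F (Fin.strictMono_castAdd n), sortPerm_comp_eq_iff F
    (Fin.strictMono_natAdd m)]
  rfl

/-- The permutation that sorts the positions of a word, bundled with its size. -/
def standardization (w : List Letter) : FinPerm := ⟨w.length, sortPerm w.get⟩

lemma standardization_ofFn {n : ℕ} (F : Fin n → Letter) :
    standardization (List.ofFn F) = ⟨n, sortPerm F⟩ := by
  have : ∀ (k : ℕ) (G : Fin k → Letter) (h : k = n), (∀ i, G i = F (Fin.cast h i)) →
      (⟨k, sortPerm G⟩ : FinPerm) = ⟨n, sortPerm F⟩ := by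
    rintro k G rfl h
    rw [show G = F from funext h]
  exact this _ _ List.length_ofFn fun i => by simp; rfl

lemma standardization_eq_iff {w : List Letter} {n : ℕ} {π : Equiv.Perm (Fin n)} :
    standardization w = ⟨n, π⟩ ↔ ∃ F : Fin n → Letter, w = List.ofFn F ∧ sortPerm F = π := by
  constructor
  · intro h
    obtain rfl : w.length = n := congrArg Sigma.fst h
    exact ⟨w.get, by simp, by simpa [standardization] using h⟩
  · rintro ⟨F, rfl, rfl⟩
    exact standardization_ofFn F

lemma standardization_mem_shuffle_iff {P P' : Set FinPerm} {u : List Letter} :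
    standardization u ∈ shuffle P P' ↔
      ∃ u₁ u₂, u = u₁ ++ u₂ ∧ standardization u₁ ∈ P ∧ standardization u₂ ∈ P' := by
  constructor
  · rintro ⟨⟨m, π⟩, hπ, ⟨n, σ⟩, hσ, ρ, hρ, h⟩
    obtain ⟨F, rfl, rfl⟩ := standardization_eq_iff.1 h
    obtain ⟨h1, h2⟩ := (sortPerm_mem_shufflePerm_iff F π σ).1 hρ
    refine ⟨List.ofFn (F ∘ Fin.castAdd n), List.ofFn (F ∘ Fin.natAdd m), ?_, ?_, ?_⟩
    · rw [← List.ofFn_fin_append]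
      congr 1
      exact (Fin.append_castAdd_natAdd (f := F)).symm
    · rwa [standardization_ofFn, h1]
    · rwa [standardization_ofFn, h2]
  · rintro ⟨u₁, u₂, rfl, h1, h2⟩
    obtain ⟨m, F₁, rfl⟩ : ∃ m, ∃ F : Fin m → Letter, u₁ = List.ofFn F := ⟨_, u₁.get, by simp⟩
    obtain ⟨n, F₂, rfl⟩ : ∃ n, ∃ F : Fin n → Letter, u₂ = List.ofFn F := ⟨_, u₂.get, by simp⟩
    rw [standardization_ofFn] at h1 h2
    refine ⟨_, h1, _, h2, sortPerm (Fin.append F₁ F₂), ?_, ?_⟩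
    · rw [sortPerm_mem_shufflePerm_iff]
      constructor
      · congr 1; ext1 i; simp
      · congr 1; ext1 i; simp
    · rw [← List.ofFn_fin_append, standardization_ofFn]

/-- No subword of `w` has its standardization in `P`. -/
def WordAvoids (P : Set FinPerm) (w : List Letter) : Prop :=
  ∀ u, u.Sublist w → standardization u ∉ P

lemma sortPerm_mem_avoiders_iff {P : Set FinPerm} {n : ℕ} (F : Fin n → Letter) :
    sortPerm F ∈ avoiders n P ↔ WordAvoids P (List.ofFn F) := by
  simp only [avoiders, mem_filter, mem_univ, true_and, WordAvoids]
  constructor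
  · intro h u hu hP
    refine h _ hP ((containsPattern_sortPerm_iff F _).2 ?_)
    obtain ⟨f, hf⟩ := List.sublist_iff_exists_fin_orderEmbedding_get_eq.1 hu
    refine ⟨f.trans (Fin.castOrderIso List.length_ofFn).toOrderEmbedding, ?_⟩
    simp only [standardization]
    congr 1
    ext1 i
    simpa using! (hf i).symm
  · rintro h ⟨k, τ⟩ hτ hc
    obtain ⟨g, hg⟩ := (containsPattern_sortPerm_iff F τ).1 hc
    refine h (List.ofFn (F ∘ g)) ?_ (by rwa [standardization_ofFn, hg])
    rw [List.sublist_iff_exists_fin_orderEmbedding_get_eq]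
    refine ⟨((Fin.castOrderIso List.length_ofFn).toOrderEmbedding.trans g).trans
      (Fin.castOrderIso List.length_ofFn.symm).toOrderEmbedding, fun i => by simp; rfl⟩

lemma WordAvoids.mono {P : Set FinPerm} {u w : List Letter} (h : WordAvoids P w)
    (hu : u.Sublist w) : WordAvoids P u := fun v hv => h v (hv.trans hu)

lemma wordAvoids_nil {P : Set FinPerm} (hP : ∀ π ∈ P, π.1 ≠ 0) : WordAvoids P [] := by
  intro u hu h
  rw [List.sublist_nil.1 hu] at h
  exact hP _ h rfl

lemma wordAvoids_shuffle_iff {P P' : Set FinPerm} {w : List Letter} :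
    WordAvoids (shuffle P P') w ↔
      ∀ k ≤ w.length, WordAvoids P (w.take k) ∨ WordAvoids P' (w.drop k) := by
  constructor
  · intro h k _
    by_contra! hc
    simp only [WordAvoids, not_forall, not_not] at hc
    obtain ⟨⟨u, hu, hP⟩, v, hv, hP'⟩ := hc
    refine h (u ++ v) ?_ (standardization_mem_shuffle_iff.2 ⟨u, v, rfl, hP, hP'⟩)
    simpa using hu.append hv
  · intro h u hu hs
    obtain ⟨u₁, u₂, rfl, h1, h2⟩ := standardization_mem_shuffle_iff.1 hs
    obtain ⟨r₁, r₂, rfl, hr1, hr2⟩ := List.append_sublist_iff.1 hu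
    rcases h r₁.length (by simp) with h | h
    · exact h u₁ (by simpa using hr1) h1
    · exact h u₂ (by simpa using hr2) h2

/-- For `A` decreasing and `B` increasing, the sum on the right has at most one nonzero term, at the
index where `B` starts to hold. -/
lemma indicator_forall_or_eq {A B : ℕ → Prop} (hA : ∀ k, A (k + 1) → A k)
    (hB : ∀ k, B k → B (k + 1)) (n : ℕ) :
    (if B n ∧ ∀ k ≤ n, A k ∨ B k then 1 else 0 : ℂ) =
      (if B 0 then 1 else 0) +
        ∑ k ∈ range n, (if A k then 1 else 0) *
          ((if B (k + 1) then 1 else 0) - if B k then 1 else 0) := by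
  induction n with
  | zero => by_cases h : B 0 <;> simp [h]
  | succ n ih =>
    rw [sum_range_succ, ← add_assoc, ← ih]
    by_cases hn : B n
    · have hs := hB n hn
      have : (∀ k ≤ n + 1, A k ∨ B k) ↔ ∀ k ≤ n, A k ∨ B k :=
        ⟨fun h k hk => h k (by omega), fun h k hk => by
          rcases Nat.le_succ_iff.1 hk with hk | rfl
          · exact h k hk
          · exact Or.inr hs⟩
      simp [hn, hs, this]
    · by_cases hs : B (n + 1)
      · have : (∀ k ≤ n + 1, A k ∨ B k) ↔ A n := by
          constructor
          · intro h
            exact (h n (by omega)).resolve_right hn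
          · intro h k hk
            rcases Nat.le_succ_iff.1 hk with hk | rfl
            · exact Or.inl (Nat.decreasingInduction' (fun j _ _ hj => hA j hj) hk h)
            · exact Or.inr hs
        simp [hn, hs, this]
      · simp [hn, hs]

/-! ### Compositions, subsets and weakly increasing sequences -/

lemma mem_compSet {n : ℕ} {β : Composition n} {x : ℕ} :
    x ∈ compSet β ↔ ∃ j, 0 < j ∧ j < β.length ∧ β.sizeUpTo j = x := by
  simp [compSet, and_assoc]

lemma sizeUpTo_lt_sizeUpTo {n : ℕ} (β : Composition n) {i j : ℕ} (hij : i < j)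
    (hj : j ≤ β.length) : β.sizeUpTo i < β.sizeUpTo j :=
  (β.sizeUpTo_strict_mono (hij.trans_le hj)).trans_le (β.monotone_sizeUpTo hij)

lemma mem_compSet_iff_exists_le {n : ℕ} {β : Composition n} {x : ℕ} :
    x ∈ compSet β ↔ (0 < x ∧ x < n) ∧ ∃ j ≤ β.length, β.sizeUpTo j = x := by
  rw [mem_compSet]
  constructor
  · rintro ⟨j, h0, hj, rfl⟩
    refine ⟨⟨?_, ?_⟩, j, hj.le, rfl⟩
    · simpa using sizeUpTo_lt_sizeUpTo β h0 hj.le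
    · simpa using sizeUpTo_lt_sizeUpTo β hj le_rfl
  · rintro ⟨⟨h0, hn⟩, j, hj, rfl⟩
    refine ⟨j, Nat.pos_of_ne_zero ?_, lt_of_le_of_ne hj ?_, rfl⟩
    · rintro rfl
      simp at h0
    · rintro rfl
      simp at hn

lemma mem_boundaries_iff {n : ℕ} {β : Composition n} {y : Fin (n + 1)} :
    y ∈ β.boundaries ↔ ∃ j ≤ β.length, β.sizeUpTo j = y := by
  simp only [Composition.boundaries, Composition.boundary, Finset.mem_map, mem_univ, true_and]
  constructor
  · rintro ⟨j, rfl⟩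
    exact ⟨j, Nat.lt_succ_iff.1 j.2, rfl⟩
  · rintro ⟨j, hj, h⟩
    exact ⟨⟨j, Nat.lt_succ_iff.2 hj⟩, Fin.ext h⟩

lemma compSet_subset {n : ℕ} (β : Composition n) : compSet β ⊆ Ioo 0 n := fun x hx => by
  simpa using (mem_compSet_iff_exists_le.1 hx).1

lemma compSet_injective {n : ℕ} : Function.Injective (compSet : Composition n → Finset ℕ) := by
  intro β β' h
  apply (compositionEquiv n).injective
  apply CompositionAsSet.ext
  change β.boundaries = β'.boundaries
  ext y
  rcases Nat.eq_zero_or_pos y with h0 | h0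
  · rw [show y = 0 from Fin.ext h0]
    exact iff_of_true β.toCompositionAsSet.zero_mem β'.toCompositionAsSet.zero_mem
  rcases (Nat.lt_succ_iff.1 y.2).eq_or_lt with hn | hn
  · rw [show y = Fin.last n from Fin.ext hn]
    exact iff_of_true β.toCompositionAsSet.getLast_mem β'.toCompositionAsSet.getLast_mem
  have := Finset.ext_iff.1 h y
  simpa only [mem_compSet_iff_exists_le, h0, hn, and_self, true_and, ← mem_boundaries_iff]
    using this

/-- Together with `compSet_injective`: compositions of `n` are the subsets of `{1, …, n - 1}`. -/
lemma exists_compSet_eq {n : ℕ} {D : Finset ℕ} (hD : D ⊆ Ioo 0 n) :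
    ∃ β : Composition n, compSet β = D := by
  let c : CompositionAsSet n :=
    { boundaries := {y | (y : ℕ) = 0 ∨ (y : ℕ) = n ∨ (y : ℕ) ∈ D}
      zero_mem := by simp
      getLast_mem := by simp }
  refine ⟨c.toComposition, ?_⟩
  ext x
  rw [mem_compSet_iff_exists_le]
  constructor
  · rintro ⟨⟨h0, hn⟩, hj⟩
    have := mem_boundaries_iff (y := ⟨x, by omega⟩).2 hj
    rw [CompositionAsSet.toComposition_boundaries] at this
    simpa [c, h0.ne', hn.ne] using this
  · intro hx
    obtain ⟨h0, hn⟩ := mem_Ioo.1 (hD hx)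
    refine ⟨⟨h0, hn⟩, mem_boundaries_iff (y := ⟨x, by omega⟩).1 ?_⟩
    rw [CompositionAsSet.toComposition_boundaries]
    simp [c, hx]

lemma sizeUpTo_gather {n : ℕ} (γ : Composition n) (c : Composition γ.length) (i : ℕ) :
    (γ.gather c).sizeUpTo i = γ.sizeUpTo (c.sizeUpTo i) := by
  set L := γ.blocks.splitWrtComposition c
  have h1 : L.flatten = γ.blocks := List.flatten_splitWrtComposition _ _
  have h2 : L.map List.length = c.blocks := List.map_length_splitWrtComposition _ _
  have h3 : (γ.gather c).blocks = L.map List.sum := rfl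
  rw [Composition.sizeUpTo, Composition.sizeUpTo, Composition.sizeUpTo, h3, ← h1, ← h2,
    List.take_sum_flatten, List.sum_flatten, List.map_take]

lemma compSet_gather {n : ℕ} (γ : Composition n) (c : Composition γ.length) :
    compSet (γ.gather c) = (compSet c).image γ.sizeUpTo := by
  ext x
  simp only [mem_compSet, mem_image, Composition.length_gather, sizeUpTo_gather]
  constructor
  · rintro ⟨j, h0, hj, rfl⟩
    exact ⟨_, ⟨j, h0, hj, rfl⟩, rfl⟩
  · rintro ⟨_, ⟨j, h0, hj, rfl⟩, rfl⟩
    exact ⟨j, h0, hj, rfl⟩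

lemma refines_iff_compSet_subset {n : ℕ} {γ β : Composition n} :
    Refines γ β ↔ compSet β ⊆ compSet γ := by
  constructor
  · rintro ⟨c, rfl⟩
    rw [compSet_gather, compSet]
    exact image_subset_image (compSet_subset c)
  · intro h
    obtain ⟨c, hc⟩ := exists_compSet_eq
      (filter_subset (fun j => γ.sizeUpTo j ∈ compSet β) (Ioo 0 γ.length))
    refine ⟨c, compSet_injective ?_⟩
    rw [compSet_gather, hc]
    ext x
    simp only [mem_image, mem_filter]
    constructor
    · rintro ⟨j, ⟨-, hj⟩, rfl⟩
      exact hj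
    · intro hx
      obtain ⟨j, hj, rfl⟩ := mem_image.1 (h hx)
      exact ⟨j, ⟨hj, hx⟩, rfl⟩

/-- The ascent set of a finite sequence, with positions counted from `1`. -/
def ascents {α : Type*} [LinearOrder α] {m : ℕ} (a : Fin (m + 1) → α) : Finset ℕ :=
  ({i : Fin m | a i.castSucc < a i.succ} : Finset (Fin m)).image fun i : Fin m => (i : ℕ) + 1

lemma mem_ascents {α : Type*} [LinearOrder α] {m : ℕ} {a : Fin (m + 1) → α} {i : Fin m} :
    (i : ℕ) + 1 ∈ ascents a ↔ a i.castSucc < a i.succ := by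
  simp [ascents, Fin.val_inj]

lemma ascents_subset {α : Type*} [LinearOrder α] {m : ℕ} (a : Fin (m + 1) → α) :
    ascents a ⊆ Ioo 0 (m + 1) := by
  intro x hx
  obtain ⟨i, -, rfl⟩ := mem_image.1 hx
  simp

/-- A weakly increasing sequence is constant wherever a weakly increasing sequence with more ascents
is. -/
lemma eq_of_ascents_subset {α β : Type*} [LinearOrder α] [LinearOrder β] {m : ℕ}
    {a : Fin (m + 1) → α} {b : Fin (m + 1) → β} (ha : Monotone a) (hb : Monotone b)
    (h : ascents a ⊆ ascents b) {v w : Fin (m + 1)} (hvw : v ≤ w) (hbe : b v = b w) :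
    a v = a w := by
  induction w using Fin.induction with
  | zero => rw [Fin.le_zero_iff.1 hvw]
  | succ i ih =>
    rcases hvw.eq_or_lt with rfl | hlt
    · rfl
    have hv : v ≤ i.castSucc := Fin.le_castSucc_iff.2 hlt
    have h1 := hb hv
    have h2 := hb i.castSucc_lt_succ.le
    have h3 : b i.castSucc = b i.succ := le_antisymm h2 (hbe ▸ h1)
    rw [ih hv (hbe.trans h3.symm)]
    refine (ha i.castSucc_lt_succ.le).eq_or_lt.resolve_right fun hlt => ?_
    exact (mem_ascents.1 (h (mem_ascents.2 hlt))).ne h3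

lemma lt_of_ascents_subset {α β : Type*} [LinearOrder α] [LinearOrder β] {m : ℕ}
    {a : Fin (m + 1) → α} {b : Fin (m + 1) → β} (ha : Monotone a) (hb : Monotone b)
    (h : ascents a ⊆ ascents b) {v w : Fin (m + 1)} (hlt : a v < a w) : b v < b w := by
  have hvw : v < w := ha.reflect_lt hlt
  exact (hb hvw.le).lt_of_ne fun he => hlt.ne (eq_of_ascents_subset ha hb h hvw.le he)

lemma monotone_index {n : ℕ} (γ : Composition n) : Monotone γ.index := by
  intro v w hvw
  by_contra! h
  have h1 := γ.sizeUpTo_index_le v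
  have h2 := γ.lt_sizeUpTo_index_succ w
  have h3 := γ.monotone_sizeUpTo (Nat.succ_le_of_lt (Fin.lt_def.1 h))
  have h4 := Fin.le_def.1 hvw
  rw [Fin.val_succ] at h2
  rw [Nat.succ_eq_add_one] at h3
  omega

/-- The block containing a position changes exactly at the partial sums of `γ`. -/
lemma ascents_index {m : ℕ} (γ : Composition (m + 1)) : ascents γ.index = compSet γ := by
  have key : ∀ i : Fin m, (i : ℕ) + 1 ∈ ascents γ.index ↔ (i : ℕ) + 1 ∈ compSet γ := by
    intro i
    rw [mem_ascents, mem_compSet]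
    have h1 := γ.sizeUpTo_index_le i.castSucc
    have h2 := γ.lt_sizeUpTo_index_succ i.castSucc
    have h3 := γ.sizeUpTo_index_le i.succ
    have h4 := γ.lt_sizeUpTo_index_succ i.succ
    simp only [Fin.val_castSucc, Fin.val_succ] at h1 h2 h3 h4
    constructor
    · intro h
      have h5 := γ.monotone_sizeUpTo (Nat.succ_le_of_lt (Fin.lt_def.1 h))
      refine ⟨γ.index i.succ, ?_, (γ.index i.succ).2, ?_⟩
      · have := Fin.lt_def.1 h
        omega
      · simp only [Nat.succ_eq_add_one] at *
        omega
    · rintro ⟨j, -, hj, he⟩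
      have h5 : ((γ.index i.castSucc : Fin _) : ℕ) < j := by
        by_contra! hc
        have := γ.monotone_sizeUpTo hc
        omega
      have h6 : j ≤ ((γ.index i.succ : Fin _) : ℕ) := by
        by_contra! hc
        have := γ.monotone_sizeUpTo (Nat.succ_le_of_lt hc)
        simp only [Nat.succ_eq_add_one] at *
        omega
      exact Fin.lt_def.2 (h5.trans_le h6)
  ext x
  constructor
  · intro hx
    obtain ⟨i, -, rfl⟩ := mem_image.1 hx
    exact (key i).1 hx
  · intro hx
    obtain ⟨h0, hn⟩ := mem_Ioo.1 (compSet_subset γ hx)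
    obtain ⟨y, rfl⟩ := Nat.exists_eq_add_of_lt h0
    simpa using (key ⟨y, by omega⟩).2 (by simpa using hx)

/-- The exponent vector of the monomial `∏ v, x_{a v}`. -/
def weight {n : ℕ} (a : Fin n → ℕ) : ℕ →₀ ℕ := ∑ v, Finsupp.single (a v) 1

lemma monomialExp_eq_weight {n : ℕ} (γ : Composition n) (i : Fin γ.length → ℕ) :
    monomialExp γ i = weight fun v => i (γ.index v) := by
  rw [weight, ← γ.blocksFinEquiv.sum_comp, Fintype.sum_sigma, monomialExp]
  refine sum_congr rfl fun j _ => ?_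
  have : ∀ y, γ.index (γ.blocksFinEquiv ⟨j, y⟩) = j := fun y => γ.index_embedding j y
  simp [this]

lemma eq_of_weight_eq {n : ℕ} {a b : Fin n → ℕ} (ha : Monotone a) (hb : Monotone b)
    (h : weight a = weight b) : a = b := by
  have key : ∀ c : Fin n → ℕ, Finsupp.toMultiset (weight c) = (List.ofFn c : Multiset ℕ) := by
    intro c
    simp only [weight, map_sum, Finsupp.toMultiset_single, one_smul]
    clear ha hb h a b
    induction n with
    | zero => simp
    | succ n ih => simp [Fin.sum_univ_succ, List.ofFn_succ, ih, Multiset.singleton_add]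
  have hp : (List.ofFn a).Perm (List.ofFn b) := Multiset.coe_eq_coe.1 (by rw [← key, ← key, h])
  exact List.ofFn_injective (hp.eq_of_pairwise' ha.sortedLE_ofFn.pairwise hb.sortedLE_ofFn.pairwise)

/-- A monomial of `M_γ` comes from the weakly increasing sequence of its variables, whose ascents
are the partial sums of `γ`. -/
lemma exists_strictMono_iff {m : ℕ} (γ : Composition (m + 1)) (d : ℕ →₀ ℕ) :
    (∃ i : Fin γ.length → ℕ, StrictMono i ∧ monomialExp γ i = d) ↔
      ∃ a : Fin (m + 1) → ℕ, Monotone a ∧ weight a = d ∧ ascents a = compSet γ := by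
  constructor
  · rintro ⟨i, hi, rfl⟩
    refine ⟨fun v => i (γ.index v), hi.monotone.comp (monotone_index γ),
      (monomialExp_eq_weight γ i).symm, ?_⟩
    rw [← ascents_index]
    simp [ascents, hi.lt_iff_lt]
  · rintro ⟨a, ha, rfl, hγ⟩
    rw [← ascents_index] at hγ
    have hpos : ∀ j : Fin γ.length, 0 < γ.blocksFun j := γ.one_le_blocksFun
    have hj : ∀ j, γ.index (γ.embedding j ⟨0, hpos j⟩) = j := fun j => γ.index_embedding j _
    refine ⟨fun j => a (γ.embedding j ⟨0, hpos j⟩), fun j j' hjj => ?_, ?_⟩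
    · apply lt_of_ascents_subset (monotone_index γ) ha hγ.ge
      rwa [hj, hj]
    · rw [monomialExp_eq_weight]
      congr 1
      ext v
      have he := hj (γ.index v)
      rcases le_total (γ.embedding (γ.index v) ⟨0, hpos _⟩) v with h | h
      · exact eq_of_ascents_subset ha (monotone_index γ) hγ.le h he
      · exact (eq_of_ascents_subset ha (monotone_index γ) hγ.le h he.symm).symm

/-! ### Peak functions as generating functions of words -/

lemma mem_symmDiff_image_succ {D : Finset ℕ} {s : ℕ} :
    s ∈ symmDiff D (D.image (· + 1)) ↔ ¬ (s ∈ D ↔ ∃ u ∈ D, u + 1 = s) := by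
  rw [Finset.mem_symmDiff, mem_image]
  exact xor_iff_not_iff _ _

lemma mem_symmDiff_singleton {D : Finset ℕ} {e x : ℕ} :
    x ∈ symmDiff D {e} ↔ ¬ (x ∈ D ↔ x = e) := by
  rw [Finset.mem_symmDiff, mem_singleton]
  exact xor_iff_not_iff _ _

lemma exists_mem_symmDiff_singleton {D : Finset ℕ} {e s : ℕ} :
    (∃ u ∈ symmDiff D {e}, u + 1 = s) ↔ ¬ ((∃ u ∈ D, u + 1 = s) ↔ e + 1 = s) := by
  cases s with
  | zero => simp
  | succ s => simp [mem_symmDiff_singleton, eq_comm]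

/-- The pairs `{s - 1, s}` for `s ∈ S` are disjoint and meet `E`, so each of them halves the number
of admissible subsets of `E`. -/
lemma two_pow_mul_card_filter {E : Finset ℕ} (S : Finset ℕ) (hS : ∀ s ∈ S, s + 1 ∉ S)
    (hE : ∀ s ∈ S, s ∈ E ∨ ∃ t ∈ E, t + 1 = s) :
    2 ^ #S * #{D ∈ E.powerset | S ⊆ symmDiff D (D.image (· + 1))} = 2 ^ #E := by
  induction S using Finset.induction_on with
  | empty => simp
  | insert s S hs ih =>
    have ih := ih (fun t ht h => hS t (mem_insert_of_mem ht) (mem_insert_of_mem h))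
      (fun t ht => hE t (mem_insert_of_mem ht))
    -- Toggling membership of `e` flips the condition at `s` and no condition at the points of `S`,
    -- since `s` and `S` contain no consecutive integers.
    obtain ⟨e, he, hes⟩ : ∃ e ∈ E, e = s ∨ e + 1 = s := by
      rcases hE s (mem_insert_self s S) with h | ⟨t, ht, h⟩
      · exact ⟨s, h, Or.inl rfl⟩
      · exact ⟨t, ht, Or.inr h⟩
    have hE' : ∀ D ∈ E.powerset, symmDiff D {e} ∈ E.powerset := by
      intro D hD
      rw [mem_powerset] at hD ⊢
      intro x hx
      by_cases hxe : x = e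
      · rwa [hxe]
      · exact hD (by simpa [mem_symmDiff_singleton, hxe] using hx)
    have hS' : ∀ D : Finset ℕ, S ⊆ symmDiff D (D.image (· + 1)) →
        S ⊆ symmDiff (symmDiff D {e}) ((symmDiff D {e}).image (· + 1)) := by
      intro D hD t ht
      have h1 : t ≠ s := fun h => hs (h ▸ ht)
      have h2 : s + 1 ≠ t := fun h => hS s (mem_insert_self s S) (mem_insert_of_mem (h ▸ ht))
      have h3 : t + 1 ≠ s := fun h => hS t (mem_insert_of_mem ht) (h ▸ mem_insert_self s S)
      have h4 : t ≠ e := by omega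
      have h5 : e + 1 ≠ t := by omega
      have := hD ht
      rw [mem_symmDiff_image_succ] at this ⊢
      rw [mem_symmDiff_singleton, exists_mem_symmDiff_singleton]
      simpa only [h4, h5, iff_false, not_not] using this
    have hs' : ∀ D : Finset ℕ, s ∈ symmDiff (symmDiff D {e}) ((symmDiff D {e}).image (· + 1)) ↔
        s ∉ symmDiff D (D.image (· + 1)) := by
      intro D
      rw [mem_symmDiff_image_succ, mem_symmDiff_image_succ, mem_symmDiff_singleton,
        exists_mem_symmDiff_singleton]
      have h : s = e ↔ ¬ e + 1 = s := by omega
      by_cases h1 : s ∈ D <;> by_cases h2 : ∃ u ∈ D, u + 1 = s <;> by_cases h3 : e + 1 = s <;>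
        simp only [h, h1, h2, h3, not_true_eq_false, not_false_eq_true, iff_true, iff_false]
    have hsplit := card_filter_add_card_filter_not
      (s := {D ∈ E.powerset | S ⊆ symmDiff D (D.image (· + 1))})
      (fun D => s ∈ symmDiff D (D.image (· + 1)))
    have hswap : #{D ∈ {D ∈ E.powerset | S ⊆ symmDiff D (D.image (· + 1))} |
          s ∈ symmDiff D (D.image (· + 1))} =
        #{D ∈ {D ∈ E.powerset | S ⊆ symmDiff D (D.image (· + 1))} |
          s ∉ symmDiff D (D.image (· + 1))} := by
      refine card_nbij' (fun D => symmDiff D {e}) (fun D => symmDiff D {e}) ?_ ?_ ?_ ?_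
      · intro D hD
        simp only [coe_filter, Set.mem_ofPred_eq, mem_filter] at hD ⊢
        exact ⟨⟨hE' D hD.1.1, hS' D hD.1.2⟩, fun h => (hs' D).1 h hD.2⟩
      · intro D hD
        simp only [coe_filter, Set.mem_ofPred_eq, mem_filter] at hD ⊢
        exact ⟨⟨hE' D hD.1.1, hS' D hD.1.2⟩, (hs' D).2 hD.2⟩
      · intro D _
        exact symmDiff_symmDiff_cancel_right _ _
      · intro D _
        exact symmDiff_symmDiff_cancel_right _ _
    have hins : {D ∈ E.powerset | insert s S ⊆ symmDiff D (D.image (· + 1))} =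
        {D ∈ {D ∈ E.powerset | S ⊆ symmDiff D (D.image (· + 1))} |
          s ∈ symmDiff D (D.image (· + 1))} := by
      ext D
      simp only [mem_filter, insert_subset_iff]
      tauto
    rw [← hswap, ← hins] at hsplit
    rw [card_insert_of_notMem hs, ← ih, ← hsplit]
    ring

/-- Prescribing the values of a Boolean function at distinct points halves the number of choices
once for each point. -/
lemma two_pow_mul_card_bool_assignments {ι κ : Type*} [Fintype ι] (T : Finset κ) (p : κ → ι)
    (v : κ → Bool) (hp : Set.InjOn p T) :
    2 ^ #T * #{ε : ι → Bool | ∀ i ∈ T, ε (p i) = v i} = 2 ^ Fintype.card ι := by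
  have h : ({ε : ι → Bool | ∀ i ∈ T, ε (p i) = v i} : Finset (ι → Bool)) =
      Fintype.piFinset fun x => {b : Bool | ∀ i ∈ T, p i = x → b = v i} := by
    ext ε
    simp only [mem_filter, mem_univ, true_and, Fintype.mem_piFinset]
    exact ⟨fun h x i hi hx => hx ▸ h i hi, fun h i hi => h _ i hi rfl⟩
  have hc : ∀ x, #{b : Bool | ∀ i ∈ T, p i = x → b = v i} = if x ∈ T.image p then 1 else 2 := by
    intro x
    split_ifs with hx
    · obtain ⟨i, hi, rfl⟩ := mem_image.1 hx
      rw [card_eq_one]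
      refine ⟨v i, ?_⟩
      ext b
      simp only [mem_filter, mem_univ, true_and, mem_singleton]
      exact ⟨fun h => h i hi rfl, fun h j hj hji => by rw [h, hp hj hi hji]⟩
    · rw [filter_true_of_mem]
      · simp
      · intro b _ i hi h
        exact absurd (mem_image.2 ⟨i, hi, h⟩) hx
  rw [h, Fintype.card_piFinset]
  simp only [hc]
  rw [prod_ite, prod_const_one, one_mul, prod_const, ← card_image_of_injOn hp, ← pow_add,
    ← Finset.card_univ, ← card_filter_add_card_filter_not (s := univ) (· ∈ T.image p),
    filter_mem_eq_inter, univ_inter]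

lemma mem_descentSet {m : ℕ} {π : Equiv.Perm (Fin (m + 1))} {s : ℕ} :
    s ∈ descentSet π ↔ ∃ i : Fin m, π i.succ < π i.castSucc ∧ (i : ℕ) + 1 = s := by
  have : s ∈ descentSet π ↔ ∃ i : Fin (m + 1),
      (∃ h : (i : ℕ) + 1 < m + 1, π ⟨(i : ℕ) + 1, h⟩ < π i) ∧ (i : ℕ) + 1 = s := by
    simp [descentSet]
  rw [this]
  constructor
  · rintro ⟨i, ⟨h, hi⟩, rfl⟩
    exact ⟨⟨i, by omega⟩, hi, rfl⟩
  · rintro ⟨i, hi, rfl⟩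
    exact ⟨i.castSucc, ⟨by simp, hi⟩, rfl⟩

lemma succ_mem_descentSet {m : ℕ} {π : Equiv.Perm (Fin (m + 1))} {i : Fin m} :
    (i : ℕ) + 1 ∈ descentSet π ↔ π i.succ < π i.castSucc := by
  rw [mem_descentSet]
  constructor
  · rintro ⟨j, hj, h⟩
    rwa [← show j = i from Fin.ext (by omega)]
  · exact fun h => ⟨i, h, rfl⟩

lemma mem_peakSet {m : ℕ} {π : Equiv.Perm (Fin (m + 1))} {s : ℕ} :
    s ∈ peakSet π ↔ ∃ i j : Fin m, i.succ = j.castSucc ∧ ¬ π i.succ < π i.castSucc ∧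
      π j.succ < π j.castSucc ∧ (j : ℕ) + 1 = s := by
  simp only [peakSet, peaksOf, mem_filter]
  constructor
  · rintro ⟨hs, h1, h⟩
    obtain ⟨j, hj, rfl⟩ := mem_descentSet.1 hs
    refine ⟨⟨j - 1, by omega⟩, j, Fin.ext ?_, fun hi => ?_, hj, rfl⟩
    · simp; omega
    · exact h _ (succ_mem_descentSet.2 hi) (by simp; omega)
  · rintro ⟨i, j, hij, hi, hj, rfl⟩
    have : (i : ℕ) + 1 = j := by simpa using congrArg Fin.val hij
    refine ⟨succ_mem_descentSet.2 hj, by omega, fun t ht h => hi ?_⟩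
    rw [← succ_mem_descentSet]
    rwa [show (i : ℕ) + 1 = t by omega]

lemma succ_notMem_peakSet {n : ℕ} {π : Equiv.Perm (Fin n)} {s : ℕ} (hs : s ∈ peakSet π) :
    s + 1 ∉ peakSet π := by
  intro h
  simp only [peakSet, peaksOf, mem_filter] at hs h
  exact h.2.2 s hs.1 rfl

/-- The position whose sign is forced if the letters at `i` and `i + 1` agree up to sign. At a
descent of `π` the first of the two must be negative, otherwise the second must be positive. -/
def signPosition {m : ℕ} (π : Equiv.Perm (Fin (m + 1))) (i : Fin m) : Fin (m + 1) :=
  if π i.succ < π i.castSucc then i.castSucc else i.succ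

lemma sortPerm_eq_iff_forall {m : ℕ} (F : Fin (m + 1) → Letter) (π : Equiv.Perm (Fin (m + 1))) :
    sortPerm F = π ↔ ∀ i : Fin m, (F (π i.castSucc)).1 < (F (π i.succ)).1 ∨
      (F (π i.castSucc)).1 = (F (π i.succ)).1 ∧
        (F (π (signPosition π i))).2 = decide (¬ π i.succ < π i.castSucc) := by
  rw [sortPerm_eq_iff, Fin.strictMono_iff_lt_succ]
  refine forall_congr' fun i => ?_
  rw [sortKey_lt_iff]
  refine or_congr_right (and_congr_right fun _ => ?_)
  have hne : π i.castSucc ≠ π i.succ := fun h => i.castSucc_lt_succ.ne (π.injective h)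
  rcases hne.lt_or_gt with h | h
  · have h' := h.not_gt
    simp only [signPosition, h, h', if_false]
    cases (F (π i.castSucc)).2 <;> cases (F (π i.succ)).2 <;> simp
  · have h' := h.not_gt
    simp only [signPosition, h, h', if_true]
    cases (F (π i.castSucc)).2 <;> cases (F (π i.succ)).2 <;> simp

lemma weight_comp_perm {n : ℕ} (a : Fin n → ℕ) (π : Equiv.Perm (Fin n)) :
    weight (fun i => a (π i)) = weight a :=
  Equiv.sum_comp π fun v => Finsupp.single (a v) 1

lemma monotone_of_sortPerm_eq {n : ℕ} {F : Fin n → Letter} {π : Equiv.Perm (Fin n)}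
    (h : sortPerm F = π) : Monotone fun i => (F (π i)).1 := by
  intro i j hij
  rcases hij.eq_or_lt with rfl | hlt
  · rfl
  · rcases (sortKey_lt_iff F _ _).1 ((sortPerm_eq_iff F π).1 h hlt) with h | h
    · exact h.le
    · exact h.1.le

/-- Once the content, hence the sorted sequence `a` of variable indices, is fixed, a word with
standardization `π` is determined by the signs of its letters. -/
lemma card_standardization_eq {m : ℕ} (π : Equiv.Perm (Fin (m + 1))) {a : Fin (m + 1) → ℕ}
    (ha : Monotone a) :
    #{w ∈ wordsOfContent (weight a) | standardization w = ⟨m + 1, π⟩} =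
      #{ε : Fin (m + 1) → Bool | ∀ i ∈ ({i : Fin m | (i : ℕ) + 1 ∉ ascents a} : Finset (Fin m)),
        ε (signPosition π i) = decide (¬ π i.succ < π i.castSucc)} := by
  symm
  have key : ∀ ε : Fin (m + 1) → Bool,
      sortPerm (fun v => (a (π.symm v), ε (π.symm v))) = π ↔
        ∀ i ∈ ({i : Fin m | (i : ℕ) + 1 ∉ ascents a} : Finset (Fin m)),
          ε (signPosition π i) = decide (¬ π i.succ < π i.castSucc) := by
    intro ε
    rw [sortPerm_eq_iff_forall]
    refine forall_congr' fun i => ?_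
    simp only [Equiv.symm_apply_apply, mem_filter, mem_univ, true_and, mem_ascents]
    rcases (ha i.castSucc_lt_succ.le).lt_or_eq with h | h
    · simp [h]
    · simp [h]
  refine card_bij (fun ε _ => List.ofFn fun v => (a (π.symm v), ε (π.symm v))) ?_ ?_ ?_
  · intro ε hε
    rw [mem_filter, mem_wordsOfContent, content_ofFn, standardization_ofFn]
    refine ⟨weight_comp_perm a π.symm, ?_⟩
    rw [(key ε).2 (mem_filter.1 hε).2]
  · intro ε _ δ _ h
    ext i
    have := congrFun (List.ofFn_injective h) (π i)
    simp only [Equiv.symm_apply_apply, Prod.mk.injEq, true_and] at this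
    rw [this]
  · intro w hw
    rw [mem_filter, mem_wordsOfContent] at hw
    obtain ⟨F, rfl, hF⟩ := standardization_eq_iff.1 hw.2
    have hFa : (fun i => (F (π i)).1) = a := by
      refine eq_of_weight_eq (monotone_of_sortPerm_eq hF) ha ?_
      rw [weight_comp_perm (fun v => (F v).1), ← hw.1, content_ofFn, weight]
    have hF' : (fun v => (a (π.symm v), (F (π (π.symm v))).2)) = F := by
      funext v
      simp [← hFa]
    refine ⟨fun i => (F (π i)).2, ?_, by rw [hF']⟩
    exact mem_filter.2 ⟨mem_univ _, (key fun i => (F (π i)).2).1 (by rw [hF', hF])⟩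

/-- The coefficient of the peak function equals the number of enriched words. -/
lemma two_pow_mul_card_eq_card_standardization {m : ℕ} (π : Equiv.Perm (Fin (m + 1)))
    {a : Fin (m + 1) → ℕ} (ha : Monotone a) :
    2 ^ (#(peakSet π) + 1) *
        #{D ∈ (ascents a).powerset | peakSet π ⊆ symmDiff D (D.image (· + 1))} =
      #{w ∈ wordsOfContent (weight a) | standardization w = ⟨m + 1, π⟩} := by
  rw [card_standardization_eq π ha]
  by_cases hE : ∀ s ∈ peakSet π, s ∈ ascents a ∨ ∃ t ∈ ascents a, t + 1 = s
  · have h1 := two_pow_mul_card_filter (peakSet π) (fun s hs => succ_notMem_peakSet hs) hE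
    set T : Finset (Fin m) := {i : Fin m | (i : ℕ) + 1 ∉ ascents a} with hT
    -- Two constraints on one sign come from an ascent of `π` followed by a descent, that is, from a
    -- peak that `hE` excludes.
    have hlt : ∀ i ∈ T, ∀ j ∈ T, signPosition π i = signPosition π j → ¬ i < j := by
      intro i hi j hj h hij
      have hij' := Fin.lt_def.1 hij
      have h' := congrArg Fin.val h
      by_cases hdi : π i.succ < π i.castSucc
      · rw [signPosition, signPosition, if_pos hdi] at h'
        split_ifs at h' <;> simp at h' <;> omega
      by_cases hdj : π j.succ < π j.castSucc
      · rw [signPosition, signPosition, if_neg hdi, if_pos hdj] at h h'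
        simp only [Fin.val_succ, Fin.val_castSucc] at h'
        simp only [hT, mem_filter, mem_univ, true_and] at hi hj
        rcases hE _ (mem_peakSet.2 ⟨i, j, h, hdi, hdj, rfl⟩) with h2 | ⟨t, ht, h2⟩
        · exact hj h2
        · rw [show t = i + 1 by omega] at ht
          exact hi ht
      · rw [signPosition, signPosition, if_neg hdi, if_neg hdj] at h'
        simp at h'
        omega
    have hinj : Set.InjOn (signPosition π) T := fun i hi j hj h =>
      le_antisymm (not_lt.1 (hlt j hj i hi h.symm)) (not_lt.1 (hlt i hi j hj h))
    have h2 := two_pow_mul_card_bool_assignments T (signPosition π)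
      (fun i => decide (¬ π i.succ < π i.castSucc)) hinj
    have h3 : #(ascents a) + #T = m := by
      have : ({i : Fin m | (i : ℕ) + 1 ∈ ascents a} : Finset (Fin m)).card = #(ascents a) := by
        simp only [mem_ascents]
        rw [ascents, card_image_of_injective]
        exact fun i j h => Fin.ext (by simpa using h)
      rw [← this, hT, card_filter_add_card_filter_not]
      simp
    have h4 : Fintype.card (Fin (m + 1)) = #(ascents a) + #T + 1 := by simp [h3]
    rw [h4] at h2
    refine Nat.eq_of_mul_eq_mul_left (pow_pos two_pos #T) ?_
    refine Eq.trans ?_ (h2.symm.trans (by congr!))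
    rw [pow_succ (2 : ℕ) #(peakSet π), mul_right_comm, h1]
    ring
  · push Not at hE
    obtain ⟨s, hs, hsE, hsE'⟩ := hE
    rw [filter_false_of_mem, filter_false_of_mem]
    · simp
    -- At the peak `j + 1` the constraints at `i = j - 1` and `j` ask for opposite signs.
    · intro ε _ hε
      obtain ⟨i, j, hij, hi, hj, rfl⟩ := mem_peakSet.1 hs
      have hij' : (i : ℕ) + 1 = j := by simpa using congrArg Fin.val hij
      have h1 := hε i (mem_filter.2 ⟨mem_univ _, fun h => hsE' _ h (by omega)⟩)
      have h2 := hε j (mem_filter.2 ⟨mem_univ _, hsE⟩)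
      rw [signPosition, if_neg hi, decide_eq_true hi, hij] at h1
      rw [signPosition, if_pos hj, decide_eq_false (not_not.2 hj), h1] at h2
      exact Bool.noConfusion h2
    · intro D hD hD'
      rw [mem_powerset] at hD
      refine mem_symmDiff_image_succ.1 (hD' hs) (iff_of_false (fun h => hsE (hD h)) ?_)
      rintro ⟨t, ht, h⟩
      exact hsE' t (hD ht) h

lemma coeff_monomialQSym {m : ℕ} (γ : Composition (m + 1)) (d : ℕ →₀ ℕ) :
    MvPowerSeries.coeff d (monomialQSym γ) =
      if ∃ a : Fin (m + 1) → ℕ, Monotone a ∧ weight a = d ∧ ascents a = compSet γ then 1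
      else 0 := by
  simp only [← exists_strictMono_iff]
  rfl

lemma coeff_weight_fundamentalQSym {m : ℕ} (β : Composition (m + 1)) {a : Fin (m + 1) → ℕ}
    (ha : Monotone a) :
    MvPowerSeries.coeff (weight a) (fundamentalQSym β) =
      if compSet β ⊆ ascents a then 1 else 0 := by
  obtain ⟨γ₀, hγ₀⟩ := exists_compSet_eq (ascents_subset a)
  have h : ∀ γ : Composition (m + 1), MvPowerSeries.coeff (weight a) (monomialQSym γ) =
      if γ = γ₀ then 1 else 0 := by
    intro γ
    rw [coeff_monomialQSym]
    congr 1
    rw [eq_iff_iff, ← compSet_injective.eq_iff, hγ₀]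
    constructor
    · rintro ⟨b, hb, hba, hγ⟩
      rw [← hγ, eq_of_weight_eq hb ha hba]
    · exact fun h => ⟨a, ha, rfl, h.symm⟩
  rw [fundamentalQSym, map_sum]
  simp only [h, sum_ite_eq', mem_filter, mem_univ, true_and, refines_iff_compSet_subset, hγ₀]

lemma coeff_peakFunction_weight {m : ℕ} (S : Finset ℕ) {a : Fin (m + 1) → ℕ} (ha : Monotone a) :
    MvPowerSeries.coeff (weight a) (peakFunction S (m + 1)) =
      ((2 ^ (#S + 1) * #{D ∈ (ascents a).powerset | S ⊆ symmDiff D (D.image (· + 1))} : ℕ) :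
        ℂ) := by
  have h2 : (2 ^ (#S + 1) : Series) = MvPowerSeries.C (2 ^ (#S + 1)) := by
    rw [map_pow, map_ofNat]
  rw [peakFunction, if_neg m.succ_ne_zero, h2, MvPowerSeries.coeff_C_mul, map_sum]
  simp only [coeff_weight_fundamentalQSym _ ha]
  rw [sum_boole, filter_filter]
  push_cast
  congr 2
  refine card_bij (fun β _ => compSet β) ?_ ?_ ?_
  · intro β hβ
    simpa [and_comm] using hβ
  · exact fun β _ β' _ h => compSet_injective h
  · intro D hD
    rw [mem_filter, mem_powerset] at hD
    obtain ⟨β, rfl⟩ := exists_compSet_eq (hD.1.trans (ascents_subset a))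
    exact ⟨β, by simpa [and_comm] using hD, rfl⟩

lemma coeff_peakFunction_eq_zero {m : ℕ} (S : Finset ℕ) {d : ℕ →₀ ℕ}
    (hd : ¬ ∃ a : Fin (m + 1) → ℕ, Monotone a ∧ weight a = d) :
    MvPowerSeries.coeff d (peakFunction S (m + 1)) = 0 := by
  have h2 : (2 ^ (#S + 1) : Series) = MvPowerSeries.C (2 ^ (#S + 1)) := by
    rw [map_pow, map_ofNat]
  rw [peakFunction, if_neg m.succ_ne_zero, h2, MvPowerSeries.coeff_C_mul, map_sum]
  refine mul_eq_zero_of_right _ (sum_eq_zero fun β _ => ?_)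
  rw [fundamentalQSym, map_sum]
  refine sum_eq_zero fun γ _ => ?_
  rw [coeff_monomialQSym, if_neg]
  exact fun ⟨a, ha, hda, _⟩ => hd ⟨a, ha, hda⟩

/-- `K_{Peak(π),n}` enumerates the enriched words with standardization `π`. -/
lemma peakFunction_peakSet_eq_wordSum {n : ℕ} (π : Equiv.Perm (Fin n)) :
    peakFunction (peakSet π) n =
      wordSum fun w => if standardization w = ⟨n, π⟩ then 1 else 0 := by
  ext d
  rw [coeff_wordSum, sum_boole]
  -- In size zero the value of the peak function is a convention, matching the empty word.
  cases n with
  | zero =>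
    have : ∀ w, standardization w = ⟨0, π⟩ ↔ w = [] := fun w => by
      rw [standardization_eq_iff]
      constructor
      · rintro ⟨F, rfl, -⟩
        simp
      · rintro rfl
        exact ⟨Fin.elim0, by simp, Subsingleton.elim _ _⟩
    rw [peakFunction, if_pos rfl, MvPowerSeries.coeff_one]
    have hd : #{w ∈ wordsOfContent d | standardization w = ⟨0, π⟩} = if d = 0 then 1 else 0 := by
      simp only [this]
      split_ifs with h
      · refine card_eq_one.2 ⟨[], ?_⟩
        ext w
        simp only [mem_filter, mem_wordsOfContent, mem_singleton, and_iff_right_iff_imp]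
        rintro rfl
        rw [h, content_nil]
      · refine card_eq_zero.2 (filter_eq_empty_iff.2 ?_)
        rintro w hw rfl
        exact h (mem_wordsOfContent.1 hw).symm
    rw [hd, Nat.cast_ite, Nat.cast_one, Nat.cast_zero]
  | succ m =>
    by_cases hd : ∃ a : Fin (m + 1) → ℕ, Monotone a ∧ weight a = d
    · obtain ⟨a, ha, rfl⟩ := hd
      rw [coeff_peakFunction_weight _ ha, two_pow_mul_card_eq_card_standardization π ha]
    · rw [coeff_peakFunction_eq_zero _ hd, filter_false_of_mem]
      · simp
      · intro w hw hs
        obtain ⟨F, rfl, hF⟩ := standardization_eq_iff.1 hs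
        refine hd ⟨_, monotone_of_sortPerm_eq hF, ?_⟩
        rw [weight_comp_perm fun v => (F v).1, ← mem_wordsOfContent.1 hw, content_ofFn, weight]

/-! ### Pattern-avoiding peak functions of shuffles -/

lemma R_eq_wordSum (n : ℕ) (P : Set FinPerm) :
    R n P = wordSum fun w => if w.length = n ∧ WordAvoids P w then 1 else 0 := by
  rw [R]
  simp only [peakFunction_peakSet_eq_wordSum]
  rw [← wordSum_sum]
  congr 1
  funext w
  by_cases hw : w.length = n
  · obtain ⟨F, rfl⟩ : ∃ F : Fin n → Letter, w = List.ofFn F := by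
      subst hw
      exact ⟨w.get, by simp⟩
    simp only [standardization_ofFn, Sigma.mk.injEq, heq_eq_eq, true_and, sum_ite_eq,
      sortPerm_mem_avoiders_iff, List.length_ofFn]
  · rw [if_neg fun h => hw h.1]
    exact sum_eq_zero fun π _ => if_neg fun h => hw (congrArg Sigma.fst h)

lemma peakFunction_empty_one_eq_wordSum :
    peakFunction ∅ 1 = wordSum fun w => if w.length = 1 then 1 else 0 := by
  have h : peakSet (1 : Equiv.Perm (Fin 1)) = ∅ := by
    ext s
    simp [mem_peakSet]
  rw [← h, peakFunction_peakSet_eq_wordSum]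
  congr 1
  funext w
  congr 1
  rw [eq_iff_iff, standardization_eq_iff]
  constructor
  · rintro ⟨F, rfl, -⟩
    simp
  · intro hw
    exact ⟨fun i => w.get (Fin.cast hw.symm i), by
      rw [← List.ofFn_congr hw w.get]; simp, Subsingleton.elim _ _⟩

lemma R_mul_sub_eq_wordSum (P P' : Set FinPerm) {n k : ℕ} (hk : k < n) :
    R k P * (peakFunction ∅ 1 * R (n - k - 1) P' - R (n - k) P') =
      wordSum fun w => if w.length = n then (if WordAvoids P (w.take k) then 1 else 0) *
        ((if WordAvoids P' (w.drop (k + 1)) then 1 else 0) -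
          if WordAvoids P' (w.drop k) then 1 else 0) else 0 := by
  rw [peakFunction_empty_one_eq_wordSum, R_eq_wordSum, R_eq_wordSum, R_eq_wordSum,
    wordSum_mul (k := 1) (fun w hw => if_neg hw), ← wordSum_sub,
    wordSum_mul (k := k) (fun w hw => if_neg fun h => hw h.1)]
  congr 1
  funext w
  simp only [List.length_take, List.length_drop, List.drop_drop]
  by_cases hw : w.length = n
  · subst hw
    simp [hk.le, Nat.sub_sub, show 1 ≤ w.length - k by omega]
  · rw [if_neg hw]
    by_cases h1 : min k w.length = k
    · have h4 : w.length - k ≠ n - k := by omega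
      by_cases h2 : min 1 (w.length - k) = 1
      · have h3 : w.length - (k + 1) ≠ n - k - 1 := by omega
        simp [h3, h4]
      · simp [h2, h4]
    · simp [h1]

lemma R_shuffle_eq (P P' : Set FinPerm) (hP' : ∀ σ ∈ P', σ.1 ≠ 0) (n : ℕ) :
    R n (shuffle P P') = R n P' + ∑ k ∈ range n,
      R k P * (peakFunction ∅ 1 * R (n - k - 1) P' - R (n - k) P') := by
  rw [sum_congr rfl fun k hk => R_mul_sub_eq_wordSum P P' (mem_range.1 hk), ← wordSum_sum,
    R_eq_wordSum, R_eq_wordSum, ← wordSum_add]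
  congr 1
  funext w
  by_cases hw : w.length = n
  · subst hw
    have h := indicator_forall_or_eq (A := fun k => WordAvoids P (w.take k))
      (B := fun k => WordAvoids P' (w.drop k))
      (fun k h => h.mono (List.take_sublist_take_left k.le_succ))
      (fun k h => h.mono (List.drop_sublist_drop_left w k.le_succ)) w.length
    simp only [List.drop_length, wordAvoids_nil hP', true_and, List.drop_zero,
      ← wordAvoids_shuffle_iff] at h
    simpa using h
  · simp [hw]

end PeakAvoid

end

theorem theorem3p13 (P P' : Set PeakAvoid.FinPerm)
    (hP : ∀ π ∈ P, π.1 ≠ 0) (hP' : ∀ σ ∈ P', σ.1 ≠ 0) (n : ℕ) :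
    PeakAvoid.R n (PeakAvoid.shuffle P P') =
      PeakAvoid.R n P' +
        ∑ k ∈ Finset.range n,
          PeakAvoid.R k P *
            (PeakAvoid.peakFunction ∅ 1 * PeakAvoid.R (n - k - 1) P' - PeakAvoid.R (n - k) P') :=
  PeakAvoid.R_shuffle_eq P P' hP' n
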